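/- Let $n\ge 1$ agents $1,\dots,n$ and $m$ items $1,\dots,m$, arranged along a path in this order, be given, and let each agent $i$ have an integral non-negative valuation $v_i:2^{[m]}\to\mathbb{Z}_{\ge 0}$ with $v_i(\emptyset)=0$ (no monotonicity is assumed). A bundle is connected if it is a (possibly empty) sub-path $[\![\ell,r]\!]=\{\ell,\dots,r\}$. A connected allocation is a partition $(A_1,\dots,A_n)$ of $[m]$ into connected bundles; it is well-ordered if the bundles lie along the path from left to right in the order $1,\dots,n$ of the agents. It is equitable up to one good and one chore over the path ($\mathrm{EQ1P}^c_g$) if for all agents $i,j$ with $v_i(A_i)<v_j(A_j)$ there is a set $X\subseteq[m]$ with $|A_i\cap X|\le 1$ and $|A_j\cap X|\le 1$ such that $A_i\setminus X$ and $A_j\setminus X$ are connected and $v_i(A_i\setminus X)\ge v_j(A_j\setminus X)$. There is an algorithm (a program for a unit-cost random access machine with integer addition, subtraction and comparison, which receives $n$ and $m$ and has access to the valuations through an oracle that returns $v_i([\![\ell,r]\!])$ for given $i,\ell,r$ in constant time) that, for every such instance, halts and outputs a well-ordered $\mathrm{EQ1P}^c_g$ allocation, in polynomial time $O(n^2m^4)$: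 there is an absolute constant $C$ such that at most $C\cdot\max\{1,n^2m^4\}$ steps are performed. -/

import Mathlib

/-! ### Allocations over a path

The items are `Fin m`, arranged along a path in their natural order; in the notation `⟦l, r⟧` they
are numbered `1, …, m`, so that `x : Fin m` is item number `x + 1`. -/

/-- The connected bundle `⟦l, r⟧` of the items numbered `l, …, r` (empty if `r < l`). -/
def pathInterval (m : ℕ) (l r : ℤ) : Finset (Fin m) :=
  Finset.univ.filter fun x => l ≤ (x : ℤ) + 1 ∧ (x : ℤ) + 1 ≤ r

/-- A bundle is connected if it is a (possibly empty) sub-path. -/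
def IsConnectedBundle {m : ℕ} (S : Finset (Fin m)) : Prop :=
  ∃ l r : ℤ, S = pathInterval m l r

/-- `A` is an allocation: the (possibly empty) bundles `A i` partition the set of items. -/
def IsAllocation {n m : ℕ} (A : Fin n → Finset (Fin m)) : Prop :=
  ∀ x, ∃! i, x ∈ A i

/-- Equitability up to one good and one chore over a path: `A` is an allocation into connected
bundles and, whenever `v i (A i) < v j (A j)`, the inequality is reversed by removing at most one
item from each of the two bundles, where a removal must leave the bundle connected. -/
def IsEQ1P {n m : ℕ} (v : Fin n → Finset (Fin m) → ℤ) (A : Fin n → Finset (Fin m)) : Prop :=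
  IsAllocation A ∧ (∀ i, IsConnectedBundle (A i)) ∧
    ∀ i j, v i (A i) < v j (A j) →
      ∃ X : Finset (Fin m), (A i ∩ X).card ≤ 1 ∧ (A j ∩ X).card ≤ 1 ∧
        IsConnectedBundle (A i \ X) ∧ IsConnectedBundle (A j \ X) ∧
        v j (A j \ X) ≤ v i (A i \ X)

/-- The bundles lie along the path from left to right in the order of the agents. -/
def IsWellOrdered {n m : ℕ} (A : Fin n → Finset (Fin m)) : Prop :=
  ∀ i j, i < j → ∀ x ∈ A i, ∀ y ∈ A j, x < y

/-! ### Machine model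

A unit-cost random access machine, presented as a structured imperative language: a program is a
fixed finite piece of syntax that works on integer registers and integer arrays. Its arithmetic
consists of addition, subtraction and comparison only. The valuations are accessible only through
an oracle, one call of which is one elementary operation. -/

/-- Memory: the registers (by name), and the arrays (by name and index). -/
structure RamState where
  reg : ℕ → ℤ
  arr : ℕ → ℤ → ℤ

inductive RamExpr where
  | const (k : ℤ)
  | reg (x : ℕ)
  | add (e₁ e₂ : RamExpr)
  | sub (e₁ e₂ : RamExpr)
  /-- Read an entry of the array `a`. -/
  | load (a : ℕ) (e : RamExpr)
  /-- Ask the oracle for agent `i`'s value of the bundle `⟦l, r⟧`. -/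
  | query (i l r : RamExpr)

/-- The value of an expression, `O` being the oracle. -/
def RamExpr.eval (O : ℤ → ℤ → ℤ → ℤ) (s : RamState) : RamExpr → ℤ
  | const k => k
  | reg x => s.reg x
  | add e₁ e₂ => e₁.eval O s + e₂.eval O s
  | sub e₁ e₂ => e₁.eval O s - e₂.eval O s
  | load a e => s.arr a (e.eval O s)
  | query i l r => O (i.eval O s) (l.eval O s) (r.eval O s)

/-- The number of elementary operations performed to evaluate an expression. -/
def RamExpr.cost : RamExpr → ℕ
  | const _ => 1
  | reg _ => 1
  | add e₁ e₂ => e₁.cost + e₂.cost + 1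
  | sub e₁ e₂ => e₁.cost + e₂.cost + 1
  | load _ e => e.cost + 1
  | query i l r => i.cost + l.cost + r.cost + 1

inductive RamProg where
  | skip
  /-- `x := e` for a register `x`. -/
  | assign (x : ℕ) (e : RamExpr)
  /-- `a[e₁] := e₂` for an array `a`. -/
  | store (a : ℕ) (e₁ e₂ : RamExpr)
  | seq (p q : RamProg)
  /-- `if e₁ ≤ e₂ then p else q`. -/
  | ite (e₁ e₂ : RamExpr) (p q : RamProg)
  /-- `while e₁ ≤ e₂ do p`. -/
  | loop (e₁ e₂ : RamExpr) (p : RamProg)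

/-- `RamExec O p s t s'`: with oracle `O`, the program `p` started in the memory `s` halts in the
memory `s'` after exactly `t` steps. -/
inductive RamExec (O : ℤ → ℤ → ℤ → ℤ) : RamProg → RamState → ℕ → RamState → Prop where
  | skip (s : RamState) : RamExec O .skip s 1 s
  | assign (x : ℕ) (e : RamExpr) (s : RamState) :
      RamExec O (.assign x e) s (e.cost + 1)
        ⟨Function.update s.reg x (e.eval O s), s.arr⟩
  | store (a : ℕ) (e₁ e₂ : RamExpr) (s : RamState) :
      RamExec O (.store a e₁ e₂) s (e₁.cost + e₂.cost + 1)
        ⟨s.reg, Function.update s.arr a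
          (Function.update (s.arr a) (e₁.eval O s) (e₂.eval O s))⟩
  | seq {p q : RamProg} {s s₁ s₂ : RamState} {t₁ t₂ : ℕ} :
      RamExec O p s t₁ s₁ → RamExec O q s₁ t₂ s₂ → RamExec O (.seq p q) s (t₁ + t₂) s₂
  | ite_true {e₁ e₂ : RamExpr} {p q : RamProg} {s s₁ : RamState} {t : ℕ} :
      e₁.eval O s ≤ e₂.eval O s → RamExec O p s t s₁ →
      RamExec O (.ite e₁ e₂ p q) s (e₁.cost + e₂.cost + 1 + t) s₁
  | ite_false {e₁ e₂ : RamExpr} {p q : RamProg} {s s₁ : RamState} {t : ℕ} :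
      ¬ e₁.eval O s ≤ e₂.eval O s → RamExec O q s t s₁ →
      RamExec O (.ite e₁ e₂ p q) s (e₁.cost + e₂.cost + 1 + t) s₁
  | loop_true {e₁ e₂ : RamExpr} {p : RamProg} {s s₁ s₂ : RamState} {t₁ t₂ : ℕ} :
      e₁.eval O s ≤ e₂.eval O s → RamExec O p s t₁ s₁ →
      RamExec O (.loop e₁ e₂ p) s₁ t₂ s₂ →
      RamExec O (.loop e₁ e₂ p) s (e₁.cost + e₂.cost + 1 + t₁ + t₂) s₂
  | loop_false {e₁ e₂ : RamExpr} {p : RamProg} {s : RamState} :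
      ¬ e₁.eval O s ≤ e₂.eval O s →
      RamExec O (.loop e₁ e₂ p) s (e₁.cost + e₂.cost + 1) s

/-- Executions are deterministic: the outcome and the number of steps are unique. -/
theorem RamExec.deterministic {O : ℤ → ℤ → ℤ → ℤ} {p : RamProg} {s s₁ : RamState} {t₁ : ℕ}
    (h : RamExec O p s t₁ s₁) :
    ∀ {t₂ : ℕ} {s₂ : RamState}, RamExec O p s t₂ s₂ → t₁ = t₂ ∧ s₁ = s₂ := by
  induction h with
  | skip s => intro _ _ h; cases h; exact ⟨rfl, rfl⟩
  | assign x e s => intro _ _ h; cases h; exact ⟨rfl, rfl⟩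
  | store a e₁ e₂ s => intro _ _ h; cases h; exact ⟨rfl, rfl⟩
  | seq _ _ ih₁ ih₂ =>
    intro _ _ h
    cases h with
    | seq k₁ k₂ => obtain ⟨rfl, rfl⟩ := ih₁ k₁; obtain ⟨rfl, rfl⟩ := ih₂ k₂; exact ⟨rfl, rfl⟩
  | ite_true hc _ ih =>
    intro _ _ h
    cases h with
    | ite_true _ k => obtain ⟨rfl, rfl⟩ := ih k; exact ⟨rfl, rfl⟩
    | ite_false hn _ => exact absurd hc hn
  | ite_false hc _ ih =>
    intro _ _ h
    cases h with
    | ite_true hn _ => exact absurd hn hc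
    | ite_false _ k => obtain ⟨rfl, rfl⟩ := ih k; exact ⟨rfl, rfl⟩
  | loop_true hc _ _ ih₁ ih₂ =>
    intro _ _ h
    cases h with
    | loop_true _ k₁ k₂ =>
      obtain ⟨rfl, rfl⟩ := ih₁ k₁; obtain ⟨rfl, rfl⟩ := ih₂ k₂; exact ⟨rfl, rfl⟩
    | loop_false hn => exact absurd hc hn
  | loop_false hc =>
    intro _ _ h
    cases h with
    | loop_true hn _ _ => exact absurd hn hc
    | loop_false _ => exact ⟨rfl, rfl⟩

/-- The valuation oracle: for an agent number `i ∈ {1, …, n}` and two endpoints `l`, `r` it returns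
the value of `⟦l, r⟧` for that agent (and `0` if there is no agent number `i`). -/
def valuationOracle {n m : ℕ} (v : Fin n → Finset (Fin m) → ℤ) (i l r : ℤ) : ℤ :=
  if h : 1 ≤ i ∧ i ≤ n then v ⟨(i - 1).toNat, by omega⟩ (pathInterval m l r) else 0

/-- Initial memory: `n` in register `0`, `m` in register `1`, and `0` everywhere else. -/
def initialState (n m : ℕ) : RamState where
  reg := fun x => if x = 0 then n else if x = 1 then m else 0
  arr := fun _ _ => 0

/-- The memory `s` represents the allocation `A`: for every item number `k ∈ {1, …, m}`, the entry
`k` of array `0` is the number of the agent who gets that item. -/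
def Represents {n m : ℕ} (s : RamState) (A : Fin n → Finset (Fin m)) : Prop :=
  ∀ (x : Fin m) (i : Fin n), x ∈ A i ↔ s.arr 0 ((x : ℤ) + 1) = (i : ℤ) + 1

/-!
# Well-ordered allocations over a path that are equitable up to one good and one chore

Call a threshold `t` *straddled* by a bundle of an agent if it lies between the least and the
greatest value, for this agent, of the bundle itself and the two bundles left by removing one of its
end items. A division of the path into connected bundles that all straddle a common `t` is equitable
up to one good and one chore: the poorer bundle can be trimmed to value at least `t`, the richer one
to value at most `t`, and the two removals do not interfere.

*Existence.* Let `S i` be the set of pairs `(y, t)` such that the first `i` agents can divide the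
items `1, …, y` with threshold `t` (`Reach`). The claim is that some `(m, t)` lies in `S n`. In a
continuous setting one would show inductively that `S i` contains a curve from `(0, 0)` to the line
`y = m`. The discrete argument is the dual one. If `S n` misses the line, then the indicator
function of `y < m` is constant along unit steps within `S n`, is `1` at the origin and `0` on the
line. Such a separating function for `S (i + 1)` is pulled back to one for `S i`
(`IsSeparating.pullBack`): the new value at `(x, t)` adds up the old values at `(y, t)` over the
right cuts `y` at which the value of the bundle between `x` and `y` crosses `t`, with signs. The
crossings move along unit steps within `S (i + 1)` when `x` or `t` moves by one, because each of the
three edges of the triangle formed by a bundle and its two trimmed versions, if crossed, makes the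
bundle straddle `t`. Arriving at `S 0`, the line `y = 0`, the function has to be constantly `1`, but
no value crosses a large threshold (`exists_reach`).

*Algorithm.* A straddled threshold can be rounded down to the value of some bundle
(`exists_reach_value`), so that `O(n m²)` thresholds have to be tried. For each of them, the table
of the sets of cuts that the first `i` agents can reach takes `O(n m²)` steps to compute by dynamic
programming (`runs_buildTable`), and an allocation is read off by backtracking (`runs_backtrack`).
The program does not stop at the first success. A later success overwrites the allocation by another
correct one (`Runs.forUp_search`).
-/

/-! ### Thresholds and cuts -/

/-- The bundle between the cuts `x` and `y` straddles `t`: the threshold lies in the range of the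
three values that `g` takes on this bundle and on the two bundles obtained from it by removing its
first or its last item. If the bundle is empty, so are the other two. -/
def Straddles (g : ℤ → ℤ → ℤ) (t x y : ℤ) : Prop :=
  min (g x y) (min (g (x + 1) y) (g x (y - 1))) ≤ t ∧
    t ≤ max (g x y) (max (g (x + 1) y) (g x (y - 1)))

/-- The first `i` agents can divide the items `1, …, y` in order into bundles that straddle
`t`; `f i x y` is the value of the items `x + 1, …, y` for the agent with index `i`. -/
def Reach (f : ℕ → ℤ → ℤ → ℤ) (t : ℤ) : ℕ → ℕ → Prop
  | 0, y => y = 0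
  | i + 1, y => ∃ x ≤ y, Reach f t i x ∧ Straddles (f i) t x y

/-- `χ` separates the point `(0, 0)` from the line `y = m` on the set `S` of pairs `(y, t)`: it does
not change along unit steps within `S`, although it is `1` at `(0, 0)` and `0` on the line. -/
structure IsSeparating (m : ℕ) (S : ℕ → ℕ → Prop) (χ : ℕ → ℕ → ℤ) : Prop where
  horizontal : ∀ y t, y < m → S y t → S (y + 1) t → χ y t = χ (y + 1) t
  vertical : ∀ y t, S y t → S y (t + 1) → χ y t = χ y (t + 1)
  origin : χ 0 0 = 1
  wall : ∀ t, χ m t = 0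

open Classical in
/-- The pull-back of `χ` along the relation between the left cut `x` and the right cut `y` of a
bundle. By summation by parts it is the sum of `χ y t` over the right cuts `y` at which
`g x · - t` changes its sign, counted with the direction of the change. -/
noncomputable def pullBack (g : ℤ → ℤ → ℤ) (m : ℕ) (χ : ℕ → ℕ → ℤ) (x t : ℕ) : ℤ :=
  ∑ y ∈ Finset.range m,
    (if x ≤ y ∧ (t : ℤ) ≤ g x y then 1 else 0) * (χ y t - χ (y + 1) t)

/-- A separating function for the pairs that `i + 1` agents can reach yields one for the pairs that
`i` agents can reach. -/
theorem IsSeparating.pullBack {f : ℕ → ℤ → ℤ → ℤ} {i m : ℕ} {χ : ℕ → ℕ → ℤ}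
    (h0 : ∀ x y, y ≤ x → f i x y = 0) (hnn : ∀ x y, 0 ≤ f i x y)
    (h : IsSeparating m (fun y t => Reach f t (i + 1) y) χ) :
    IsSeparating m (fun y t => Reach f t i y) (pullBack (f i) m χ) := by
  classical
  have key : ∀ {x y t : ℕ}, Reach f t i x → x ≤ y → Straddles (f i) t x y →
      Reach f t (i + 1) y := fun {x y t} hr hxy hs => ⟨x, hxy, hr, hs⟩
  refine ⟨?_, ?_, ?_, ?_⟩
  · intro x t _ hx hx'
    unfold _root_.pullBack
    refine Finset.sum_congr rfl fun y hy => ?_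
    rw [Finset.mem_range] at hy
    by_cases hD : (x ≤ y ∧ (t : ℤ) ≤ f i x y) ↔ (x + 1 ≤ y ∧ (t : ℤ) ≤ f i (x + 1 : ℕ) y)
    · simp only [hD]
    -- A change of sign between the left cuts `x` and `x + 1` puts both `y` and `y + 1` into the
    -- next stage, each with one of these two left cuts.
    have hxy : x ≤ y := by by_contra hc; exact hD (by omega)
    have h1 : Reach f t (i + 1) y ∧ Reach f t (i + 1) (y + 1) := by
      rcases hxy.eq_or_lt with rfl | hlt
      · have ht : (t : ℤ) = 0 := by
          have := h0 x x le_rfl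
          have h2 : ¬ (x + 1 ≤ x) := by omega
          simp only [h2, false_and, iff_false, le_refl, true_and, not_not, this] at hD
          omega
        exact ⟨key hx le_rfl (by simp [Straddles, h0, ht]),
          key hx' le_rfl (by simp [Straddles, h0, ht])⟩
      · have hD' : ¬ ((t : ℤ) ≤ f i x y ↔ (t : ℤ) ≤ f i (x + 1 : ℕ) y) := by
          intro hc; exact hD (by simp [hc, hxy, Nat.succ_le_of_lt hlt])
        push_cast at hD'
        refine ⟨key hx hxy (by unfold Straddles; omega), ?_⟩
        by_cases hs : ((t : ℤ) ≤ f i (x + 1) y ↔ (t : ℤ) ≤ f i (x + 1) (y + 1))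
        · refine key hx (by omega) ?_
          unfold Straddles
          push_cast
          rw [add_sub_cancel_right]
          omega
        · refine key hx' (by omega) ?_
          unfold Straddles
          push_cast
          rw [add_sub_cancel_right]
          omega
    have h2 := h.horizontal y t hy h1.1 h1.2
    rw [h2]; simp
  · intro x t hx hx'
    unfold _root_.pullBack
    set σ : ℕ → ℕ → ℤ := fun s y => if x ≤ y ∧ (s : ℤ) ≤ f i x y then 1 else 0 with hσ
    set e : ℕ → ℤ := fun y => χ y t - χ y (t + 1) with he
    -- Raising the threshold from `t` to `t + 1` changes the sign at `y` only if `f i x y = t`, and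
    -- then the bundles that end at `y` and at `y + 1` straddle `t`.
    have h1 : ∀ y ∈ Finset.range m, σ t y * (χ y t - χ (y + 1) t) =
        σ (t + 1) y * (χ y t - χ (y + 1) t) := by
      intro y hy
      rw [Finset.mem_range] at hy
      by_cases hD : x ≤ y ∧ (t : ℤ) = f i x y
      · have h2 := h.horizontal y t hy
          (key hx hD.1 (by unfold Straddles; omega))
          (key hx (by omega) (by unfold Straddles; push_cast; rw [add_sub_cancel_right]; omega))
        rw [h2]; simp
      · have : (x ≤ y ∧ (t : ℤ) ≤ f i x y) ↔ (x ≤ y ∧ ((t + 1 : ℕ) : ℤ) ≤ f i x y) := by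
          push_cast; omega
        simp only [hσ, this]
    -- At a change of sign at the level `t + 1`, the bundle straddles both `t` and `t + 1`.
    have h2 : ∀ y, (σ (t + 1) (y + 1) - σ (t + 1) y) * e (y + 1) = 0 := by
      intro y
      by_cases hD : (x ≤ y ∧ ((t + 1 : ℕ) : ℤ) ≤ f i x y) ↔
          (x ≤ y + 1 ∧ ((t + 1 : ℕ) : ℤ) ≤ f i x (y + 1 : ℕ))
      · simp only [hσ, hD, sub_self, zero_mul]
      have hxy : x ≤ y := by
        by_contra hc
        have := h0 x (y + 1 : ℕ) (by omega)
        exact hD (by omega)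
      have h3 : ∀ s : ℕ, s = t ∨ s = t + 1 → Straddles (f i) s x (y + 1 : ℕ) := by
        intro s hs
        unfold Straddles
        push_cast at hD ⊢
        rw [add_sub_cancel_right]
        omega
      have h4 := h.vertical (y + 1) t (key hx (by omega) (h3 t (Or.inl rfl)))
        (key hx' (by omega) (h3 _ (Or.inr rfl)))
      simp [he, h4]
    have h3 : σ (t + 1) 0 = 0 := by
      simp only [hσ, ite_eq_right_iff, one_ne_zero, imp_false, not_and]
      intro hx0
      have := h0 x (0 : ℕ) (by omega)
      omega
    have h4 : e m = 0 := by simp [he, h.wall]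
    -- What remains is zero by summation by parts.
    rw [Finset.sum_congr rfl h1, ← sub_eq_zero, ← Finset.sum_sub_distrib]
    calc _ = ∑ y ∈ Finset.range m, ((σ (t + 1) y * e y - σ (t + 1) (y + 1) * e (y + 1)) +
          (σ (t + 1) (y + 1) - σ (t + 1) y) * e (y + 1)) := by
            refine Finset.sum_congr rfl fun y _ => ?_
            simp only [he]; ring
      _ = 0 := by
            rw [Finset.sum_add_distrib, Finset.sum_range_sub' (fun y => σ (t + 1) y * e y)]
            simp [h2, h3, h4]
  · have : ∀ y : ℕ, (0 ≤ y ∧ ((0 : ℕ) : ℤ) ≤ f i (0 : ℕ) y) := fun y => ⟨Nat.zero_le _, hnn _ _⟩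
    simp only [_root_.pullBack, this, and_self, if_true, one_mul]
    rw [Finset.sum_range_sub' (fun y => χ y 0), h.origin, h.wall, sub_zero]
  · intro t
    refine Finset.sum_eq_zero fun y hy => ?_
    rw [Finset.mem_range] at hy
    simp [hy]

/-- Some threshold admits a division of the whole path: otherwise the indicator function of `y < m`
would be separating, and pulling it back to the stage before the first agent, where the line `y = 0`
connects the origin with all thresholds, leads to a contradiction. -/
theorem exists_reach {f : ℕ → ℤ → ℤ → ℤ} {n m : ℕ} (hn : 0 < n) (hm : 0 < m)
    (h0 : ∀ i x y, y ≤ x → f i x y = 0) (hnn : ∀ i x y, 0 ≤ f i x y) :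
    ∃ t : ℕ, Reach f t n m := by
  by_contra! hno
  have hlast : ∃ χ, IsSeparating m (fun y t => Reach f t n y) χ := by
    refine ⟨fun y _ => if y < m then 1 else 0, ?_, fun _ _ _ _ => rfl, by simp [hm], by simp⟩
    intro y t hy _ h2
    have : y + 1 ≠ m := by rintro rfl; exact hno t h2
    have : y + 1 < m := by omega
    simp [this, hy]
  have hone : ∃ χ, IsSeparating m (fun y t => Reach f t 1 y) χ := by
    obtain ⟨k, rfl⟩ := Nat.exists_eq_succ_of_ne_zero hn.ne'
    clear hno hn
    induction k with
    | zero => exact hlast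
    | succ k ih =>
      obtain ⟨χ, hχ⟩ := hlast
      exact ih ⟨_, hχ.pullBack (h0 _) (hnn _)⟩
  obtain ⟨χ, hχ⟩ := hone
  have hz := hχ.pullBack (h0 0) (hnn 0)
  have hconst : ∀ t, pullBack (f 0) m χ 0 t = 1 := by
    intro t
    induction t with
    | zero => exact hz.origin
    | succ t ih => rw [← hz.vertical 0 t rfl rfl, ih]
  -- Above all values of the first agent the pull-back vanishes.
  obtain ⟨T, hT⟩ := ((Finset.range m).image fun y : ℕ => (f 0 0 y).toNat).exists_le
  have hvanish : pullBack (f 0) m χ 0 (T + 1) = 0 := by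
    refine Finset.sum_eq_zero fun y hy => ?_
    have h1 := hT _ (Finset.mem_image_of_mem _ hy)
    have h2 : ¬ ((T + 1 : ℕ) : ℤ) ≤ f 0 (0 : ℕ) y := by
      push_cast
      omega
    simp only [h2, and_false, if_false, zero_mul]
  rw [hconst] at hvanish
  exact one_ne_zero hvanish

/-- The threshold can be chosen among the values of the bundles, as rounding a threshold down to the
nearest value preserves being straddled. -/
theorem exists_reach_value {f : ℕ → ℤ → ℤ → ℤ} {n m : ℕ} (hn : 0 < n) (hm : 0 < m)
    (h0 : ∀ i x y, y ≤ x → f i x y = 0) (hnn : ∀ i x y, 0 ≤ f i x y) :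
    ∃ j < n, ∃ p ≤ m, ∃ q ≤ m, Reach f (f j (p : ℕ) (q : ℕ)) n m := by
  obtain ⟨t, ht⟩ := exists_reach hn hm h0 hnn
  set V : Finset ℤ := ((Finset.range n ×ˢ Finset.range (m + 1) ×ˢ Finset.range (m + 1)).image
    fun a => f a.1 (a.2.1 : ℕ) (a.2.2 : ℕ)).filter (· ≤ (t : ℤ)) with hV
  have hmem : ∀ j p q : ℕ, j < n → p ≤ m → q ≤ m → f j p q ≤ t → f j p q ∈ V := by
    intro j p q hj hp hq hle
    rw [hV, Finset.mem_filter, Finset.mem_image]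
    exact ⟨⟨(j, p, q), by simp; omega, rfl⟩, hle⟩
  have hne : V.Nonempty :=
    ⟨_, hmem 0 0 0 hn (Nat.zero_le _) (Nat.zero_le _) (by rw [h0 _ _ _ le_rfl]; omega)⟩
  have hmax := V.max'_mem hne
  have hle := V.le_max'
  set t' := V.max' hne
  rw [hV, Finset.mem_filter, Finset.mem_image] at hmax
  obtain ⟨⟨⟨j, p, q⟩, hjpq, hv⟩, htt⟩ := hmax
  simp only [Finset.mem_product, Finset.mem_range] at hjpq hv
  refine ⟨j, hjpq.1, p, by omega, q, by omega, ?_⟩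
  rw [hv]
  have hnn' : 0 ≤ t' := hv ▸ hnn _ _ _
  have hround : ∀ i < n, ∀ x y : ℤ, 0 ≤ x → y ≤ m → f i x y ≤ t → f i x y ≤ t' := by
    intro i hi x y hx hy h
    rcases le_or_gt y x with hyx | hxy
    · rwa [h0 i x y hyx]
    · lift x to ℕ using hx
      lift y to ℕ using by omega
      exact hle _ (hmem i x y hi (by omega) (by omega) h)
  have : ∀ i ≤ n, ∀ y ≤ m, Reach f t i y → Reach f t' i y := by
    intro i
    induction i with
    | zero => exact fun _ _ _ h => h
    | succ i ih =>
      rintro hi y hy ⟨x, hxy, hr, hs⟩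
      refine ⟨x, hxy, ih (by omega) x (by omega) hr, ?_⟩
      have h1 := hround i (by omega) x y (by omega) (by omega)
      have h2 := hround i (by omega) (x + 1) y (by omega) (by omega)
      have h3 := hround i (by omega) x (y - 1) (by omega) (by omega)
      unfold Straddles at *
      omega
  exact this n le_rfl m le_rfl ht

/-! ### Bounded total correctness of programs -/

/-- Total correctness within a time bound: `p` started in `s` halts after at most `T` steps in a
memory that satisfies `Q`. -/
def Runs (O : ℤ → ℤ → ℤ → ℤ) (p : RamProg) (s : RamState) (T : ℕ) (Q : RamState → Prop) : Prop :=
  ∃ t s', RamExec O p s t s' ∧ t ≤ T ∧ Q s'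

section Runs

variable {O : ℤ → ℤ → ℤ → ℤ} {p q : RamProg} {s : RamState} {T T' : ℕ} {Q Q' : RamState → Prop}

theorem Runs.mono (h : Runs O p s T Q) (hT : T ≤ T') (hQ : ∀ s', Q s' → Q' s') :
    Runs O p s T' Q' := by
  obtain ⟨t, s', he, ht, hq⟩ := h
  exact ⟨t, s', he, ht.trans hT, hQ _ hq⟩

theorem Runs.seq (h : Runs O p s T (fun s' => Runs O q s' T' Q)) :
    Runs O (.seq p q) s (T + T') Q := by
  obtain ⟨t, s', he, ht, t', s'', he', ht', hq⟩ := h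
  exact ⟨_, s'', .seq he he', by omega, hq⟩

/-- The effect of a program without loops (loops are skipped). -/
def RamProg.step (O : ℤ → ℤ → ℤ → ℤ) : RamProg → RamState → RamState
  | .skip, s => s
  | .assign x e, s => ⟨Function.update s.reg x (e.eval O s), s.arr⟩
  | .store a e₁ e₂, s =>
      ⟨s.reg, Function.update s.arr a (Function.update (s.arr a) (e₁.eval O s) (e₂.eval O s))⟩
  | .seq p q, s => q.step O (p.step O s)
  | .ite e₁ e₂ p q, s => if e₁.eval O s ≤ e₂.eval O s then p.step O s else q.step O s
  | .loop _ _ _, s => s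

/-- An upper bound on the running time of a program without loops. -/
def RamProg.bound : RamProg → ℕ
  | .skip => 1
  | .assign _ e => e.cost + 1
  | .store _ e₁ e₂ => e₁.cost + e₂.cost + 1
  | .seq p q => p.bound + q.bound
  | .ite e₁ e₂ p q => e₁.cost + e₂.cost + 1 + (p.bound + q.bound)
  | .loop _ _ _ => 0

/-- Whether a program contains no loop. -/
def RamProg.loopFree : RamProg → Bool
  | .seq p q => p.loopFree && q.loopFree
  | .ite _ _ p q => p.loopFree && q.loopFree
  | .loop _ _ _ => false
  | _ => true

theorem Runs.of_loopFree (hp : p.loopFree = true) (hT : p.bound ≤ T) (hQ : Q (p.step O s)) :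
    Runs O p s T Q := by
  suffices h : ∃ t ≤ p.bound, RamExec O p s t (p.step O s) by
    obtain ⟨t, ht, he⟩ := h
    exact ⟨t, _, he, ht.trans hT, hQ⟩
  clear hT hQ
  induction p generalizing s with
  | skip => exact ⟨_, le_rfl, .skip s⟩
  | assign x e => exact ⟨_, le_rfl, .assign x e s⟩
  | store a e₁ e₂ => exact ⟨_, le_rfl, .store a e₁ e₂ s⟩
  | seq p q ihp ihq =>
    simp only [RamProg.loopFree, Bool.and_eq_true] at hp
    obtain ⟨t, ht, he⟩ := ihp (s := s) hp.1
    obtain ⟨t', ht', he'⟩ := ihq (s := p.step O s) hp.2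
    exact ⟨_, Nat.add_le_add ht ht', .seq he he'⟩
  | ite e₁ e₂ p q ihp ihq =>
    simp only [RamProg.loopFree, Bool.and_eq_true] at hp
    simp only [RamProg.bound, RamProg.step]
    split_ifs with hc
    · obtain ⟨t, ht, he⟩ := ihp (s := s) hp.1
      exact ⟨_, by omega, .ite_true hc he⟩
    · obtain ⟨t, ht, he⟩ := ihq (s := s) hp.2
      exact ⟨_, by omega, .ite_false hc he⟩
  | loop => simp [RamProg.loopFree] at hp

theorem Runs.ite {e₁ e₂ : RamExpr} (hp : e₁.eval O s ≤ e₂.eval O s → Runs O p s T Q)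
    (hq : ¬ e₁.eval O s ≤ e₂.eval O s → Runs O q s T Q) :
    Runs O (.ite e₁ e₂ p q) s (e₁.cost + e₂.cost + 1 + T) Q := by
  by_cases hc : e₁.eval O s ≤ e₂.eval O s
  · obtain ⟨t, s', he, ht, h⟩ := hp hc
    exact ⟨_, s', .ite_true hc he, by omega, h⟩
  · obtain ⟨t, s', he, ht, h⟩ := hq hc
    exact ⟨_, s', .ite_false hc he, by omega, h⟩

/-- `for x := 0; e₁ ≤ e₂; x := x + 1 do p`. -/
def RamProg.forUp (x : ℕ) (e₁ e₂ : RamExpr) (p : RamProg) : RamProg :=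
  .seq (.assign x (.const 0)) (.loop e₁ e₂ (.seq p (.assign x (.add (.reg x) (.const 1)))))

/-- The invariant rule for a loop that makes `N` rounds of at most `B` steps. -/
theorem Runs.forUp {x : ℕ} {e₁ e₂ : RamExpr} (I : ℕ → RamState → Prop) (N B : ℕ)
    (h0 : I 0 ⟨Function.update s.reg x 0, s.arr⟩)
    (hg : ∀ k s, k ≤ N → I k s → (e₁.eval O s ≤ e₂.eval O s ↔ k < N))
    (hb : ∀ k s, k < N → I k s → Runs O p s B fun s' =>
      I (k + 1) ⟨Function.update s'.reg x (s'.reg x + 1), s'.arr⟩)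
    (hQ : ∀ s, I N s → Q s)
    (hT : N * (e₁.cost + e₂.cost + 5 + B) + (e₁.cost + e₂.cost + 3) ≤ T) :
    Runs O (.forUp x e₁ e₂ p) s T Q := by
  set c := e₁.cost + e₂.cost with hc
  have hloop : ∀ d k s, k + d = N → I k s →
      Runs O (.loop e₁ e₂ (.seq p (.assign x (.add (.reg x) (.const 1))))) s
        (d * (c + 5 + B) + (c + 1)) Q := by
    intro d
    induction d with
    | zero =>
      intro k s hk hI
      obtain rfl : k = N := by omega
      refine ⟨_, s, .loop_false ?_, by omega, hQ _ hI⟩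
      rw [hg k s le_rfl hI]
      exact lt_irrefl k
    | succ d ih =>
      intro k s hk hI
      obtain ⟨t, s₁, he, ht, hI₁⟩ := hb k s (by omega) hI
      obtain ⟨t', s₂, he', ht', hq⟩ := ih (k + 1) _ (by omega) hI₁
      refine ⟨_, s₂, .loop_true ((hg k s (by omega) hI).2 (by omega))
        (.seq he (.assign x _ s₁)) he', ?_, hq⟩
      simp only [RamExpr.cost]
      rw [Nat.succ_mul]
      omega
  obtain ⟨t, s', he, ht, hq⟩ := hloop N 0 _ (by omega) h0
  refine ⟨_, s', .seq (.assign x (.const 0) s) he, ?_, hq⟩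
  simp only [RamExpr.cost]
  omega

/-- The rule for exhaustive search: if each round establishes `G` whenever its candidate `k`
satisfies `H k`, and no round destroys `G`, then the loop establishes `G` as soon as some candidate
satisfies `H`. -/
theorem Runs.forUp_search {x : ℕ} {e₁ e₂ : RamExpr} (G : (ℤ → ℤ) → Prop) (H : ℕ → Prop)
    (N B : ℕ)
    (hg : ∀ (k : ℕ) (s' : RamState), (∀ r < x, s'.reg r = s.reg r) → s'.reg x = k →
      (e₁.eval O s' ≤ e₂.eval O s' ↔ k < N))
    (hb : ∀ (k : ℕ) (s' : RamState), k < N → (∀ r < x, s'.reg r = s.reg r) → s'.reg x = k →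
      Runs O p s' B fun s'' =>
        (∀ r < x + 1, s''.reg r = s'.reg r) ∧ (G (s'.arr 0) ∨ H k → G (s''.arr 0)))
    (hT : N * (e₁.cost + e₂.cost + 5 + B) + (e₁.cost + e₂.cost + 3) ≤ T) :
    Runs O (.forUp x e₁ e₂ p) s T fun s' =>
      (∀ r < x, s'.reg r = s.reg r) ∧ (G (s.arr 0) ∨ (∃ k < N, H k) → G (s'.arr 0)) := by
  refine Runs.forUp (fun (k : ℕ) (s' : RamState) => (∀ r < x, s'.reg r = s.reg r) ∧
    s'.reg x = (k : ℕ) ∧ (G (s.arr 0) ∨ (∃ k' < k, H k') → G (s'.arr 0))) N B ?_ ?_ ?_ ?_ hT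
  · refine ⟨fun r hr => ?_, by simp, by simp⟩
    simp [hr.ne]
  · exact fun k s' _ h => hg k s' h.1 h.2.1
  · rintro k s' hk ⟨h1, h2, h3⟩
    refine (hb k s' hk h1 h2).mono le_rfl fun s'' h => ⟨fun r hr => ?_, ?_, ?_⟩
    · dsimp only
      rw [Function.update_of_ne hr.ne, h.1 r (by omega), h1 r hr]
    · simp [h.1 x (by omega), h2]
    · rintro (hG | ⟨k', hk', hH⟩)
      · exact h.2 (Or.inl (h3 (Or.inl hG)))
      · rcases Nat.lt_succ_iff_lt_or_eq.1 hk' with hlt | rfl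
        · exact h.2 (Or.inl (h3 (Or.inr ⟨k', hlt, hH⟩)))
        · exact h.2 (Or.inr hH)
  · exact fun s' h => ⟨h.1, h.2.2⟩

end Runs

/-! ### The dynamic program -/

namespace RamProg

-- Register `0` holds `n` and register `1` holds `m`; the registers `2`, `3`, `4` run through the
-- candidates for the threshold, which is kept in register `5`. Only higher registers are used to
-- build and to read the table. Array `1` holds the table, array `0` the allocation.

/-- Extend the range from `reg 11` to `reg 12` by the value of `e`. -/
def widen (e : RamExpr) : RamProg :=
  .seq (.assign 13 e)
    (.seq (.ite (.reg 13) (.reg 11) (.assign 11 (.reg 13)) .skip)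
      (.ite (.reg 12) (.reg 13) (.assign 12 (.reg 13)) .skip))

/-- Set register `9` to `x = reg 10` if the previous row of the table, which starts at `reg 6`,
marks the cut `x` as reachable and the bundle between the cuts `x` and `reg 8` straddles the
threshold `reg 5` for agent `reg 7 + 1`. -/
def tryCut : RamProg :=
  .ite (.const 0) (.load 1 (.add (.reg 6) (.reg 10)))
    (.seq (.seq
      (.assign 11 (.query (.add (.reg 7) (.const 1)) (.add (.reg 10) (.const 1)) (.reg 8)))
      (.assign 12 (.reg 11)))
    (.seq (widen (.query (.add (.reg 7) (.const 1))
      (.add (.add (.reg 10) (.const 1)) (.const 1)) (.reg 8)))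
    (.seq (widen (.query (.add (.reg 7) (.const 1)) (.add (.reg 10) (.const 1))
      (.sub (.reg 8) (.const 1))))
    (.ite (.reg 11) (.reg 5) (.ite (.reg 5) (.reg 12) (.assign 9 (.reg 10)) .skip) .skip))))
    .skip

/-- Set register `9` to a left cut for the bundle of agent `reg 7 + 1` that ends at the cut `reg 8`,
or to `-1` if there is none. -/
def findCut : RamProg :=
  .seq (.assign 9 (.const (-1))) (forUp 10 (.reg 10) (.reg 8) tryCut)

/-- Write the table row of agent `reg 7 + 1`, of length `m + 1`, behind the row at `reg 6`. -/
def fillRow : RamProg :=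
  forUp 8 (.reg 8) (.reg 1) (.seq findCut
    (.store 1 (.add (.add (.reg 6) (.add (.reg 1) (.const 1))) (.reg 8)) (.reg 9)))

/-- Write all rows of the table for the threshold `reg 5`; the last row starts at `reg 6`. -/
def buildTable : RamProg :=
  .seq (forUp 8 (.reg 8) (.reg 1) (.store 1 (.reg 8) (.const (-1))))
    (.seq (.store 1 (.const 0) (.const 0))
    (.seq (.assign 6 (.const 0))
    (forUp 7 (.add (.reg 7) (.const 1)) (.reg 0)
      (.seq fillRow (.assign 6 (.add (.reg 6) (.add (.reg 1) (.const 1))))))))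

/-- Read off an allocation from the table, for the agents `n, …, 1` in this order: `reg 11` is the
agent, `reg 9` and `reg 8` are the left and the right cut of the bundle. -/
def backtrack : RamProg :=
  .seq (.seq (.assign 8 (.reg 1)) (.assign 11 (.reg 0)))
    (forUp 7 (.add (.reg 7) (.const 1)) (.reg 0)
      (.seq (.seq (.assign 6 (.sub (.reg 6) (.add (.reg 1) (.const 1))))
        (.assign 9 (.load 1 (.add (.add (.reg 6) (.add (.reg 1) (.const 1))) (.reg 8)))))
      (.seq (forUp 10 (.add (.add (.reg 9) (.reg 10)) (.const 1)) (.reg 8)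
        (.store 0 (.add (.add (.reg 9) (.reg 10)) (.const 1)) (.reg 11)))
      (.seq (.assign 8 (.reg 9)) (.assign 11 (.sub (.reg 11) (.const 1)))))))

/-- Try the value of the bundle between the cuts `reg 3` and `reg 4` for agent `reg 2 + 1` as a
threshold, and write an allocation if there is one for it. -/
def tryThreshold : RamProg :=
  .seq (.assign 5 (.query (.add (.reg 2) (.const 1)) (.add (.reg 3) (.const 1)) (.reg 4)))
    (.seq buildTable
    (.ite (.const 0) (.load 1 (.add (.reg 6) (.reg 1))) backtrack .skip))

/-- Try all thresholds. Every success overwrites the allocation that is in the memory. -/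
def findAllocation : RamProg :=
  .ite (.reg 1) (.const 0) .skip
    (forUp 2 (.add (.reg 2) (.const 1)) (.reg 0)
      (forUp 3 (.reg 3) (.reg 1) (forUp 4 (.reg 4) (.reg 1) tryThreshold)))

end RamProg

/-- The value of the items `x + 1, …, y` for the agent with index `i`. -/
def cutValue (O : ℤ → ℤ → ℤ → ℤ) (i : ℕ) (x y : ℤ) : ℤ := O (i + 1) (x + 1) y

/-- `w` is `-1` or a witness below `k` of `P`, the former only if there is no witness. -/
def IsWitness (P : ℕ → Prop) (k : ℕ) (w : ℤ) : Prop :=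
  (w = -1 ∧ ∀ x < k, ¬ P x) ∨ ∃ x < k, P x ∧ w = x

theorem IsWitness.nonneg_iff {P : ℕ → Prop} {k : ℕ} {w : ℤ} (h : IsWitness P k w) :
    0 ≤ w ↔ ∃ x < k, P x := by
  rcases h with ⟨rfl, h⟩ | ⟨x, hx, hP, rfl⟩
  · simpa using h
  · exact ⟨fun _ => ⟨x, hx, hP⟩, fun _ => by omega⟩

/-- `x` is marked in the table row at `b`, and it is a suitable left end for a bundle that ends at
`y`. -/
def IsCandidate (g : ℤ → ℤ → ℤ) (t : ℤ) (a : ℤ → ℤ) (b : ℤ) (y x : ℕ) : Prop :=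
  0 ≤ a (b + x) ∧ Straddles g t x y

/-- Row `r` of the table, at the addresses `r * (m + 1), …, r * (m + 1) + m`, is correct relative to
the row before it. -/
def TableRow (f : ℕ → ℤ → ℤ → ℤ) (t : ℤ) (m : ℕ) (a : ℤ → ℤ) : ℕ → Prop
  | 0 => ∀ y : ℕ, y ≤ m → (0 ≤ a y ↔ y = 0)
  | r + 1 => ∀ y : ℕ, y ≤ m → IsWitness (IsCandidate (f r) t a ((r * (m + 1) : ℕ) : ℤ) y) (y + 1)
      (a (((r + 1) * (m + 1) : ℕ) + y))

/-- The non-negative entries of a correct table mark the reachable cuts. -/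
theorem TableRow.nonneg_iff {f : ℕ → ℤ → ℤ → ℤ} {t : ℤ} {m : ℕ} {a : ℤ → ℤ} {k : ℕ}
    (h : ∀ r ≤ k, TableRow f t m a r) :
    ∀ r ≤ k, ∀ y ≤ m, 0 ≤ a ((r * (m + 1) : ℕ) + y) ↔ Reach f t r y := by
  intro r
  induction r with
  | zero =>
    intro hr y hy
    simpa [Reach] using h 0 hr y hy
  | succ r ih =>
    intro hr y hy
    rw [(h (r + 1) hr y hy).nonneg_iff, Reach]
    constructor
    · rintro ⟨x, hx, ha, hs⟩
      exact ⟨x, by omega, (ih (by omega) x (by omega)).1 ha, hs⟩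
    · rintro ⟨x, hx, ha, hs⟩
      exact ⟨x, by omega, (ih (by omega) x (by omega)).2 ha, hs⟩

/-! ### Correctness and running time -/

section Specifications

variable {O : ℤ → ℤ → ℤ → ℤ} {s : RamState} {n m i y : ℕ}

theorem runs_widen {e : RamExpr} : Runs O (.widen e) s (e.cost + 13) fun s' =>
    s'.arr = s.arr ∧ (∀ r < 11, s'.reg r = s.reg r) ∧
      s'.reg 11 = min (s.reg 11) (e.eval O s) ∧ s'.reg 12 = max (s.reg 12) (e.eval O s) := by
  refine Runs.of_loopFree rfl (by simp [RamProg.widen, RamProg.bound, RamExpr.cost]) ?_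
  generalize hv : e.eval O s = v
  have hne : ∀ r < 11, r ≠ 13 ∧ r ≠ 11 ∧ r ≠ 12 := fun r hr => by omega
  by_cases h1 : v ≤ s.reg 11 <;> by_cases h2 : s.reg 12 ≤ v <;>
    simp +contextual [RamProg.widen, RamProg.step, RamExpr.eval, hv, h1, h2, hne] <;> omega

open Classical in
theorem runs_tryCut {x : ℕ} (hi : s.reg 7 = i) (hy : s.reg 8 = y) (hx : s.reg 10 = x) :
    Runs O .tryCut s 100 fun s' => s'.arr = s.arr ∧ (∀ r < 9, s'.reg r = s.reg r) ∧
      s'.reg 10 = x ∧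
      s'.reg 9 = if IsCandidate (cutValue O i) (s.reg 5) (s.arr 1) (s.reg 6) y x then (x : ℤ)
        else s.reg 9 := by
  refine (Runs.ite (T := 93) (fun h0 => ?_) (fun h0 => ?_)).mono (by decide) fun _ h => h
  · simp only [RamExpr.eval, hx] at h0
    refine (Runs.seq (T := 12) (T' := 80) (.of_loopFree rfl (by decide) ?_)).mono
      (by norm_num) fun _ h => h
    refine (Runs.seq (T' := 57) (runs_widen.mono le_rfl fun s₂ h₂ => ?_)).mono
      (by simp [RamExpr.cost]) fun _ h => h
    refine (Runs.seq (T' := 20) (runs_widen.mono le_rfl fun s₃ h₃ => ?_)).mono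
      (by simp [RamExpr.cost]) fun _ h => h
    refine .of_loopFree rfl (by decide) ?_
    obtain ⟨ha₂, hr₂, hl₂, hu₂⟩ := h₂
    obtain ⟨ha₃, hr₃, hl₃, hu₃⟩ := h₃
    simp [RamProg.step, RamExpr.eval, hi, hy, hx, hr₂] at ha₂ hr₂ hl₂ hu₂ hl₃ hu₃
    have hr : ∀ r < 11, s₃.reg r = s.reg r := fun r h => by
      rw [hr₃ r h, hr₂ r h, Function.update_of_ne (by omega), Function.update_of_ne (by omega)]
    rw [hl₂] at hl₃
    rw [hu₂] at hu₃
    have hst : IsCandidate (cutValue O i) (s.reg 5) (s.arr 1) (s.reg 6) y x ↔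
        s₃.reg 11 ≤ s.reg 5 ∧ s.reg 5 ≤ s₃.reg 12 := by
      unfold IsCandidate Straddles cutValue
      rw [hl₃, hu₃]
      simp only [h0, true_and, min_assoc, max_assoc]
    rw [ha₂] at ha₃
    simp only [RamProg.step, RamExpr.eval, hr 5 (by omega), hr 10 (by omega), hst, hx]
    split_ifs with h1 h2 h3 <;> first | (exfalso; omega) | skip
    · refine ⟨ha₃, fun r h => ?_, ?_, ?_⟩
      · dsimp only
        rw [Function.update_of_ne (by omega), hr r (by omega)]
      · simp [hr 10, hx]
      · simp
    · exact ⟨ha₃, fun r h => hr r (by omega), by rw [hr 10 (by omega), hx], hr 9 (by omega)⟩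
    · exact ⟨ha₃, fun r h => hr r (by omega), by rw [hr 10 (by omega), hx], hr 9 (by omega)⟩
  · simp only [RamExpr.eval, hx] at h0
    exact .of_loopFree rfl (by decide) (by simp [RamProg.step, h0, hx, IsCandidate])

theorem runs_findCut (hi : s.reg 7 = i) (hy : s.reg 8 = y) :
    Runs O .findCut s (120 * (y + 1)) fun s' => s'.arr = s.arr ∧ (∀ r < 9, s'.reg r = s.reg r) ∧
      IsWitness (IsCandidate (cutValue O i) (s.reg 5) (s.arr 1) (s.reg 6) y) (y + 1)
        (s'.reg 9) := by
  classical
  refine (Runs.seq (T := 2) (T' := 107 * (y + 1) + 5) (.of_loopFree rfl (by decide) ?_)).mono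
      (by omega) fun _ h => h
  refine Runs.forUp (fun (k : ℕ) (s' : RamState) => s'.arr = s.arr ∧
    (∀ r < 9, s'.reg r = s.reg r) ∧ s'.reg 10 = (k : ℕ) ∧
      IsWitness (IsCandidate (cutValue O i) (s.reg 5) (s.arr 1) (s.reg 6) y) k (s'.reg 9))
    (y + 1) 100 ?_ ?_ ?_ (fun s' h => ⟨h.1, h.2.1, h.2.2.2⟩) ?_
  · refine ⟨rfl, fun r h => ?_, by simp, Or.inl ?_⟩
    · simp [RamProg.step, show r ≠ 10 by omega, show r ≠ 9 by omega]
    · simp [RamProg.step, RamExpr.eval]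
  · rintro k s' - ⟨-, hr, hk, -⟩
    simp only [RamExpr.eval, hk, hr 8 (by omega), hy]
    omega
  · rintro k s' hk ⟨ha, hr, hx, hw⟩
    refine (runs_tryCut ((hr 7 (by omega)).trans hi) ((hr 8 (by omega)).trans hy) hx).mono
      le_rfl ?_
    rintro s'' ⟨ha', hr', hx', hw'⟩
    rw [ha, hr 5 (by omega), hr 6 (by omega)] at hw'
    refine ⟨ha'.trans ha, fun r h => ?_, by simp [hx'], ?_⟩
    · dsimp only
      rw [Function.update_of_ne (by omega), hr' r h, hr r h]
    · dsimp only
      rw [Function.update_of_ne (by omega), hw']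
      split_ifs with hc
      · exact Or.inr ⟨k, by omega, hc, rfl⟩
      · rcases hw with ⟨h1, h2⟩ | ⟨x, h1, h2⟩
        · refine Or.inl ⟨h1, fun x hx => ?_⟩
          rcases Nat.lt_succ_iff_lt_or_eq.1 hx with h | rfl
          · exact h2 x h
          · exact hc
        · exact Or.inr ⟨x, by omega, h2⟩
  · simp only [RamExpr.cost]; omega

/-- Witnesses below `k` depend only on the first `k` entries of the table row at `b`. -/
theorem IsWitness.congr_table {g : ℤ → ℤ → ℤ} {t b : ℤ} {a a' : ℤ → ℤ} {k : ℕ} {w : ℤ}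
    (h : ∀ x : ℕ, x < k → a' (b + x) = a (b + x))
    (hw : IsWitness (IsCandidate g t a b y) k w) : IsWitness (IsCandidate g t a' b y) k w := by
  have : ∀ x < k, IsCandidate g t a' b y x ↔ IsCandidate g t a b y x := by
    intro x hx
    simp only [IsCandidate, h x hx]
  rcases hw with ⟨h1, h2⟩ | ⟨x, h1, h2, h3⟩
  · exact Or.inl ⟨h1, fun x hx => (this x hx).not.2 (h2 x hx)⟩
  · exact Or.inr ⟨x, h1, (this x h1).2 h2, h3⟩

theorem runs_fillRow (hm : s.reg 1 = m) (hi : s.reg 7 = i) :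
    Runs O .fillRow s (150 * (m + 1) ^ 2) fun s' =>
      (∀ a, a ≠ 1 → s'.arr a = s.arr a) ∧ (∀ r < 8, s'.reg r = s.reg r) ∧
      (∀ z < s.reg 6 + (m + 1), s'.arr 1 z = s.arr 1 z) ∧
      ∀ y : ℕ, y ≤ m → IsWitness
        (IsCandidate (cutValue O i) (s.reg 5) (s'.arr 1) (s.reg 6) y) (y + 1)
        (s'.arr 1 (s.reg 6 + (m + 1) + y)) := by
  refine Runs.forUp (fun (k : ℕ) (s' : RamState) => (∀ a, a ≠ 1 → s'.arr a = s.arr a) ∧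
    (∀ r < 8, s'.reg r = s.reg r) ∧ s'.reg 8 = (k : ℕ) ∧
    (∀ z < s.reg 6 + (m + 1), s'.arr 1 z = s.arr 1 z) ∧
      ∀ y : ℕ, y < k → IsWitness
        (IsCandidate (cutValue O i) (s.reg 5) (s.arr 1) (s.reg 6) y) (y + 1)
        (s'.arr 1 (s.reg 6 + (m + 1) + y)))
    (m + 1) (120 * (m + 1) + 9) ?_ ?_ ?_ ?_ ?_
  · refine ⟨fun _ _ => rfl, fun r h => ?_, by simp, fun _ _ => rfl, by simp⟩
    simp [show r ≠ 8 by omega]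
  · rintro k s' - ⟨-, hr, hk, -⟩
    simp only [RamExpr.eval, hk, hr 1 (by omega), hm]
    omega
  · rintro k s' hk ⟨ha, hr, hy, hz, hw⟩
    refine (Runs.seq (T' := 9) ((runs_findCut ((hr 7 (by omega)).trans hi) hy).mono
      le_rfl fun s₁ h₁ => .of_loopFree rfl (by decide) ?_)).mono
      (by gcongr; omega) fun _ h => h
    obtain ⟨ha₁, hr₁, hw₁⟩ := h₁
    rw [hr 5 (by omega), hr 6 (by omega)] at hw₁
    have hb : s₁.reg 6 + (s₁.reg 1 + 1) + s₁.reg 8 = s.reg 6 + (m + 1) + k := by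
      rw [hr₁ 6 (by omega), hr₁ 1 (by omega), hr₁ 8 (by omega), hr 6 (by omega),
        hr 1 (by omega), hm, hy]
    simp only [RamProg.step, RamExpr.eval, hb]
    refine ⟨fun a h => ?_, fun r h => ?_, by simp [hr₁, hy], fun z h => ?_, fun y h => ?_⟩
    · rw [Function.update_of_ne h, ha₁, ha a h]
    · rw [Function.update_of_ne (by omega), hr₁ r (by omega), hr r h]
    · rw [Function.update_self, Function.update_of_ne (by omega), ha₁, hz z h]
    · rw [Function.update_self]
      rcases Nat.lt_succ_iff_lt_or_eq.1 h with h | rfl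
      · rw [Function.update_of_ne (by omega), ha₁]
        exact hw y h
      · rw [Function.update_self]
        refine IsWitness.congr_table (fun x hx => ?_) hw₁
        rw [hz _ (by omega)]
  · rintro s' ⟨ha, hr, -, hz, hw⟩
    refine ⟨ha, hr, hz, fun y h => IsWitness.congr_table (fun x hx => ?_) (hw y (by omega))⟩
    rw [hz _ (by omega)]
  · simp only [RamExpr.cost]
    nlinarith


theorem TableRow.congr {f : ℕ → ℤ → ℤ → ℤ} {t : ℤ} {a a' : ℤ → ℤ} {r : ℕ}
    (h : ∀ z : ℤ, z < ((r + 1) * (m + 1) : ℕ) → a' z = a z) (ha : TableRow f t m a r) :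
    TableRow f t m a' r := by
  cases r with
  | zero =>
    intro y hy
    rw [h y (by push_cast; omega)]
    exact ha y hy
  | succ r =>
    intro y hy
    have hr : ((r + 1 + 1) * (m + 1) : ℕ) = (r + 1) * (m + 1) + (m + 1) := by ring
    have hr' : ((r + 1) * (m + 1) : ℕ) = r * (m + 1) + (m + 1) := by ring
    rw [h _ (by rw [hr]; push_cast; omega)]
    refine IsWitness.congr_table (fun x hx => h _ ?_) (ha y hy)
    rw [hr, hr']
    push_cast
    omega

theorem runs_buildTable (hn : s.reg 0 = n) (hm : s.reg 1 = m) :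
    Runs O .buildTable s (200 * (n + 1) * (m + 1) ^ 2) fun s' =>
      (∀ a, a ≠ 1 → s'.arr a = s.arr a) ∧ (∀ r < 6, s'.reg r = s.reg r) ∧
      s'.reg 6 = (n * (m + 1) : ℕ) ∧
      ∀ r ≤ n, TableRow (cutValue O) (s.reg 5) m (s'.arr 1) r := by
  have hinit : Runs O (.forUp 8 (.reg 8) (.reg 1) (.store 1 (.reg 8) (.const (-1)))) s
      (12 * (m + 1) + 5) fun s' => (∀ a, a ≠ 1 → s'.arr a = s.arr a) ∧
      (∀ r < 6, s'.reg r = s.reg r) ∧ ∀ y : ℕ, y ≤ m → s'.arr 1 y = -1 := by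
    refine Runs.forUp (fun (k : ℕ) (s' : RamState) => (∀ a, a ≠ 1 → s'.arr a = s.arr a) ∧
      (∀ r < 6, s'.reg r = s.reg r) ∧ s'.reg 8 = (k : ℕ) ∧ ∀ y : ℕ, y < k → s'.arr 1 y = -1)
      (m + 1) 4 ?_ ?_ ?_ ?_ ?_
    · refine ⟨fun _ _ => rfl, fun r h => ?_, by simp, by simp⟩
      simp [show r ≠ 8 by omega]
    · rintro k s' - ⟨-, hr, hk, -⟩
      simp only [RamExpr.eval, hk, hr 1 (by omega), hm]
      omega
    · rintro k s' hk ⟨ha, hr, hy, hw⟩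
      refine .of_loopFree rfl (by decide) ?_
      simp only [RamProg.step, RamExpr.eval, hy]
      refine ⟨fun a h => ?_, fun r h => ?_, by simp, fun y h => ?_⟩
      · rw [Function.update_of_ne h, ha a h]
      · rw [Function.update_of_ne (by omega), hr r h]
      · rw [Function.update_self]
        rcases Nat.lt_succ_iff_lt_or_eq.1 h with h | rfl
        · rw [Function.update_of_ne (by omega), hw y h]
        · rw [Function.update_self]
    · exact fun s' h => ⟨h.1, h.2.1, fun y hy => h.2.2.2 y (by omega)⟩
    · simp only [RamExpr.cost]; omega
  have hsq : m + 1 ≤ (m + 1) ^ 2 := Nat.le_self_pow two_ne_zero _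
  have hnsq : n * 1 ≤ n * (m + 1) ^ 2 := Nat.mul_le_mul_left _ (by omega)
  refine (Runs.seq (T' := 5 + (n * (150 * (m + 1) ^ 2 + 20) + 10))
    (hinit.mono le_rfl fun s₁ h₁ => ?_)).mono (by linarith) fun _ h => h
  obtain ⟨ha₁, hr₁, hy₁⟩ := h₁
  refine (Runs.seq (T := 3) (T' := 2 + (n * (150 * (m + 1) ^ 2 + 20) + 10))
    (.of_loopFree rfl (by decide) ?_)).mono (by omega) fun _ h => h
  refine Runs.seq (T := 2) (.of_loopFree rfl (by decide) ?_)
  simp only [RamProg.step, RamExpr.eval]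
  refine Runs.forUp (fun (k : ℕ) (s' : RamState) => (∀ a, a ≠ 1 → s'.arr a = s.arr a) ∧
    (∀ r < 6, s'.reg r = s.reg r) ∧ s'.reg 7 = (k : ℕ) ∧ s'.reg 6 = (k * (m + 1) : ℕ) ∧
      ∀ r ≤ k, TableRow (cutValue O) (s.reg 5) m (s'.arr 1) r)
    n (150 * (m + 1) ^ 2 + 6) ?_ ?_ ?_ ?_ ?_
  · dsimp only
    refine ⟨fun a h => ?_, fun r h => ?_, by simp, by simp, ?_⟩
    · rw [Function.update_of_ne h, ha₁ a h]
    · rw [Function.update_of_ne (by omega), Function.update_of_ne (by omega), hr₁ r h]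
    · intro r hr
      obtain rfl : r = 0 := by omega
      intro y hy
      rw [Function.update_self]
      by_cases h : y = 0
      · simp [h]
      · rw [Function.update_of_ne (by exact_mod_cast h), hy₁ y hy]
        simp [h]
  · rintro k s' - ⟨-, hr, hk, -⟩
    simp only [RamExpr.eval, hk, hr 0 (by omega), hn]
    omega
  · rintro k s' hk ⟨ha, hr, hi, hb, ht⟩
    refine Runs.seq ((runs_fillRow ((hr 1 (by omega)).trans hm) hi).mono le_rfl
      fun s₂ h₂ => .of_loopFree rfl (by decide) ?_)
    obtain ⟨ha₂, hr₂, hz₂, hw₂⟩ := h₂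
    have hnext : ((k + 1) * (m + 1) : ℕ) = ((k * (m + 1) : ℕ) : ℤ) + (m + 1) := by
      push_cast; ring
    simp only [RamProg.step, RamExpr.eval, hr₂ 6 (by omega), hr₂ 1 (by omega), hb,
      hr 1 (by omega), hm]
    refine ⟨fun a h => by rw [ha₂ a h, ha a h], fun r h => ?_, ?_, ?_, fun r h => ?_⟩
    · rw [Function.update_of_ne (by omega), Function.update_of_ne (by omega), hr₂ r (by omega),
        hr r h]
    · simp [hr₂, hi]
    · rw [Function.update_of_ne (by omega), Function.update_self, hnext]
    · rcases Nat.le_succ_iff.1 h with h | rfl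
      · refine TableRow.congr (fun z hz => hz₂ z ?_) (ht r h)
        rw [hb, ← hnext]
        refine hz.trans_le ?_
        exact_mod_cast Nat.mul_le_mul_right _ (by omega)
      · intro y hy
        have := hw₂ y hy
        rwa [hr 5 (by omega), hb, ← hnext] at this
  · exact fun s' h => ⟨h.1, h.2.1, h.2.2.2⟩
  · simp only [RamExpr.cost]
    have : n * (1 + 1 + 1 + 1 + 5 + (150 * (m + 1) ^ 2 + 6)) ≤ n * (150 * (m + 1) ^ 2 + 20) :=
      Nat.mul_le_mul_left _ (by omega)
    omega

/-- The entries of `a` describe, for the agents with the indices `r, …, n - 1`, bundles that divide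
the items `y + 1, …, m` in order and straddle `t`; `c` lists the cuts. -/
def IsCutting (f : ℕ → ℤ → ℤ → ℤ) (t : ℤ) (n m : ℕ) (a : ℤ → ℤ) (r y : ℕ) : Prop :=
  ∃ c : ℕ → ℕ, c r = y ∧ c n = m ∧ ∀ i, r ≤ i → i < n →
    y ≤ c i ∧ c i ≤ c (i + 1) ∧ Straddles (f i) t (c i) (c (i + 1)) ∧
      ∀ z : ℕ, c i < z → z ≤ c (i + 1) → a z = i + 1

/-- Prepend the bundle `x + 1, …, y` of the agent with index `r`. -/
theorem IsCutting.cons {f : ℕ → ℤ → ℤ → ℤ} {t : ℤ} {a a' : ℤ → ℤ} {r x y : ℕ}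
    (h : IsCutting f t n m a (r + 1) y) (hr : r < n) (hxy : x ≤ y) (hs : Straddles (f r) t x y)
    (ha : ∀ z : ℤ, a' z = if x < z ∧ z ≤ y then (r : ℤ) + 1 else a z) :
    IsCutting f t n m a' r x := by
  obtain ⟨c, hc, hn, hi⟩ := h
  refine ⟨Function.update c r x, by simp, by rw [Function.update_of_ne hr.ne', hn], ?_⟩
  intro i hri hin
  rcases hri.eq_or_lt with rfl | hlt
  · simp only [Function.update_self, Function.update_of_ne (Nat.succ_ne_self r), hc]
    refine ⟨le_rfl, hxy, hs, fun z h1 h2 => ?_⟩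
    rw [ha, if_pos (by omega)]
  · obtain ⟨h1, h2, h3, h4⟩ := hi i hlt hin
    rw [Function.update_of_ne (by omega), Function.update_of_ne (by omega)]
    refine ⟨by omega, h2, h3, fun z hz hz' => ?_⟩
    rw [ha, if_neg (by omega), h4 z hz hz']

theorem runs_backtrack {t : ℤ} (hn : s.reg 0 = n) (hm : s.reg 1 = m)
    (hb : s.reg 6 = (n * (m + 1) : ℕ))
    (ht : ∀ r ≤ n, TableRow (cutValue O) t m (s.arr 1) r) (hreach : Reach (cutValue O) t n m) :
    Runs O .backtrack s (80 * (n + 1) * (m + 1)) fun s' => (∀ r < 6, s'.reg r = s.reg r) ∧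
      IsCutting (cutValue O) t n m (s'.arr 0) 0 0 := by
  refine (Runs.seq (T := 4) (T' := n * (70 * (m + 1)) + 7)
    (.of_loopFree rfl (by decide) ?_)).mono (by nlinarith) fun _ h => h
  refine Runs.forUp (fun (k : ℕ) (s' : RamState) => ∃ r y : ℕ, r + k = n ∧ y ≤ m ∧
    s'.reg 7 = (k : ℕ) ∧ s'.reg 11 = (r : ℕ) ∧ s'.reg 8 = (y : ℕ) ∧
    s'.reg 6 = (r * (m + 1) : ℕ) ∧ (∀ r < 6, s'.reg r = s.reg r) ∧ s'.arr 1 = s.arr 1 ∧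
    Reach (cutValue O) t r y ∧ IsCutting (cutValue O) t n m (s'.arr 0) r y)
    n (20 * (m + 1) + 36) ?_ ?_ ?_ ?_ ?_
  · refine ⟨n, m, rfl, le_rfl, by simp, ?_, ?_, ?_, fun r h => ?_, rfl, hreach,
      fun _ => m, rfl, rfl, fun i h1 h2 => by omega⟩
    · simp [RamProg.step, RamExpr.eval, hn]
    · simp [RamProg.step, RamExpr.eval, hm]
    · simp [RamProg.step, hb]
    · simp [RamProg.step, show r ≠ 7 by omega, show r ≠ 8 by omega, show r ≠ 11 by omega]
  · rintro k s' - ⟨r, y, -, -, hk, -, -, -, hr, -⟩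
    simp only [RamExpr.eval, hk, hr 0 (by omega), hn]
    omega
  · rintro k s' hk ⟨r, y, hrk, hy, h7, h11, h8, h6, hr, ha, hR, hC⟩
    obtain ⟨r, rfl⟩ : ∃ r', r = r' + 1 := ⟨r - 1, by omega⟩
    have hprev : ((r + 1) * (m + 1) : ℕ) - ((m : ℤ) + 1) = (r * (m + 1) : ℕ) := by
      push_cast; ring
    -- The table names a left end for the bundle of the current agent.
    obtain ⟨x, hxy, hcand, hx⟩ : ∃ x < y + 1,
        IsCandidate (cutValue O r) t (s.arr 1) ((r * (m + 1) : ℕ) : ℤ) y x ∧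
          s.arr 1 (((r + 1) * (m + 1) : ℕ) + y) = x := by
      have h0 := (TableRow.nonneg_iff ht (r + 1) (by omega) y hy).2 hR
      rcases ht (r + 1) (by omega) y hy with ⟨h, -⟩ | h
      · omega
      · exact h
    have hRx := (TableRow.nonneg_iff ht r (by omega) x (by omega)).1 hcand.1
    refine (Runs.seq (T := 15) (T' := 20 * (m + 1) + 21) (.of_loopFree rfl (by decide) ?_)).mono
      (by omega) fun _ h => h
    set s₁ := RamProg.step O (.seq (.assign 6 (.sub (.reg 6) (.add (.reg 1) (.const 1))))
        (.assign 9 (.load 1 (.add (.add (.reg 6) (.add (.reg 1) (.const 1))) (.reg 8))))) s'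
      with hs₁
    have h6₁ : s₁.reg 6 = (r * (m + 1) : ℕ) := by
      rw [← hprev, ← h6]
      simp [hs₁, RamProg.step, RamExpr.eval, hr 1, hm]
    have h9₁ : s₁.reg 9 = x := by
      rw [← hx, ← h6, ← ha]
      simp [hs₁, RamProg.step, RamExpr.eval, h8]
    have hr₁ : ∀ q, q ≠ 6 → q ≠ 9 → s₁.reg q = s'.reg q := by
      intro q h h'
      simp [hs₁, RamProg.step, h, h']
    have ha₁ : s₁.arr = s'.arr := rfl
    clear_value s₁
    have hfill : Runs O (.forUp 10 (.add (.add (.reg 9) (.reg 10)) (.const 1)) (.reg 8)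
        (.store 0 (.add (.add (.reg 9) (.reg 10)) (.const 1)) (.reg 11))) s₁
        (18 * (m + 1) + 9) fun s₂ => (∀ q, q ≠ 10 → s₂.reg q = s₁.reg q) ∧
          s₂.arr 1 = s₁.arr 1 ∧
          ∀ z : ℤ, s₂.arr 0 z = if x < z ∧ z ≤ y then (r : ℤ) + 1 else s₁.arr 0 z := by
      refine Runs.forUp (fun (k : ℕ) (s₂ : RamState) => (∀ q, q ≠ 10 → s₂.reg q = s₁.reg q) ∧
        s₂.reg 10 = (k : ℕ) ∧ s₂.arr 1 = s₁.arr 1 ∧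
        ∀ z : ℤ, s₂.arr 0 z = if x < z ∧ z ≤ x + k then (r : ℤ) + 1 else s₁.arr 0 z)
        (y - x) 7 ?_ ?_ ?_ ?_ ?_
      · refine ⟨fun q h => ?_, by simp, rfl, fun z => ?_⟩
        · simp [h]
        · rw [if_neg (by omega)]
      · rintro k s₂ - ⟨hq, h10, -⟩
        simp only [RamExpr.eval, hq 9 (by omega), h10, h9₁, hq 8 (by omega),
          hr₁ 8 (by omega) (by omega), h8]
        omega
      · rintro k s₂ hk ⟨hq, h10, ha₂, hz⟩
        refine .of_loopFree rfl (by decide) ?_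
        simp only [RamProg.step, RamExpr.eval, hq 9 (by omega), h10, h9₁, hq 11 (by omega),
          hr₁ 11 (by omega) (by omega), h11]
        refine ⟨fun q h => ?_, by simp, ?_, fun z => ?_⟩
        · rw [Function.update_of_ne h, hq q h]
        · rw [Function.update_of_ne (by omega), ha₂]
        · rw [Function.update_self]
          by_cases hzk : z = x + k + 1
          · rw [hzk, Function.update_self, if_pos (by omega)]
            push_cast; rfl
          · rw [Function.update_of_ne hzk, hz]
            exact if_congr (by omega) rfl rfl
      · rintro s₂ ⟨h1, -, h2, h3⟩
        refine ⟨h1, h2, fun z => ?_⟩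
        rw [h3]
        exact if_congr (by omega) rfl rfl
      · simp only [RamExpr.cost]; omega
    refine (Runs.seq (T' := 6) (hfill.mono le_rfl fun s₂ h₂ =>
      .of_loopFree rfl (by decide) ?_)).mono (by omega) fun _ h => h
    obtain ⟨hr₂, ha₂, hz₂⟩ := h₂
    simp only [RamProg.step, RamExpr.eval]
    refine ⟨r, x, by omega, by omega, ?_, ?_, ?_, ?_, fun q h => ?_, ?_, hRx, ?_⟩
    · simp [hr₂, hr₁, h7]
    · simp [hr₂, hr₁, h11]
    · simp [hr₂, h9₁]
    · rw [← h6₁]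
      simp [hr₂]
    · rw [Function.update_of_ne (by omega), Function.update_of_ne (by omega),
        Function.update_of_ne (by omega), hr₂ q (by omega), hr₁ q (by omega) (by omega), hr q h]
    · rw [ha₂, ha₁, ha]
    · rw [ha₁] at hz₂
      exact hC.cons (by omega) (by omega) hcand.2 hz₂
  · rintro s' ⟨r, y, hrn, -, -, -, -, -, hr, -, hR, hC⟩
    obtain rfl : r = 0 := by omega
    obtain rfl : y = 0 := hR
    exact ⟨hr, hC⟩
  · simp only [RamExpr.cost]
    have : n * (1 + 1 + 1 + 1 + 5 + (20 * (m + 1) + 36)) ≤ n * (70 * (m + 1)) :=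
      Nat.mul_le_mul_left _ (by omega)
    omega

theorem runs_tryThreshold {j p q : ℕ} (hn : s.reg 0 = n) (hm : s.reg 1 = m)
    (hj : s.reg 2 = j) (hp : s.reg 3 = p) (hq : s.reg 4 = q) :
    Runs O .tryThreshold s (300 * (n + 1) * (m + 1) ^ 2) fun s' =>
      (∀ r < 5, s'.reg r = s.reg r) ∧
      ((∃ t, IsCutting (cutValue O) t n m (s.arr 0) 0 0) ∨
        Reach (cutValue O) (cutValue O j p q) n m →
        ∃ t, IsCutting (cutValue O) t n m (s'.arr 0) 0 0) := by
  have hT : 1 ≤ (n + 1) * (m + 1) := Nat.mul_pos n.succ_pos m.succ_pos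
  refine (Runs.seq (T := 9)
    (T' := 200 * (n + 1) * (m + 1) ^ 2 + (6 + 80 * (n + 1) * (m + 1)))
    (.of_loopFree rfl (by decide) ?_)).mono (by nlinarith) fun _ h => h
  set s₁ := RamProg.step O (.assign 5 (.query (.add (.reg 2) (.const 1))
    (.add (.reg 3) (.const 1)) (.reg 4))) s with hs₁
  have h5 : s₁.reg 5 = cutValue O j p q := by
    simp [hs₁, RamProg.step, RamExpr.eval, hj, hp, hq, cutValue]
  have hr₁ : ∀ r < 5, s₁.reg r = s.reg r := fun r h => by
    simp [hs₁, RamProg.step, h.ne]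
  have ha₁ : s₁.arr = s.arr := rfl
  clear_value s₁
  refine Runs.seq ((runs_buildTable ((hr₁ 0 (by omega)).trans hn)
    ((hr₁ 1 (by omega)).trans hm)).mono le_rfl fun s₂ h₂ => ?_)
  obtain ⟨ha₂, hr₂, hb₂, ht₂⟩ := h₂
  have hm₂ : s₂.reg 1 = m := by rw [hr₂ 1 (by omega), hr₁ 1 (by omega), hm]
  have hn₂ : s₂.reg 0 = n := by rw [hr₂ 0 (by omega), hr₁ 0 (by omega), hn]
  have hr : ∀ r < 5, s₂.reg r = s.reg r := fun r h => by rw [hr₂ r (by omega), hr₁ r h]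
  rw [h5] at ht₂
  have hiff := TableRow.nonneg_iff ht₂ n le_rfl m le_rfl
  rw [← hb₂, ← hm₂] at hiff
  refine Runs.ite (fun h => ?_) (fun h => ?_)
  · refine (runs_backtrack hn₂ hm₂ hb₂ ht₂ (hiff.1 h)).mono le_rfl fun s₃ h₃ => ?_
    exact ⟨fun r h => by rw [h₃.1 r (by omega), hr r h], fun _ => ⟨_, h₃.2⟩⟩
  · refine .of_loopFree rfl (by simp only [RamProg.bound]; nlinarith) ?_
    refine ⟨hr, fun h' => ?_⟩
    rcases h' with h' | h'
    · simp only [RamProg.step]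
      rwa [ha₂ 0 (by omega), ha₁]
    · exact absurd (hiff.2 h') h

theorem runs_findAllocation (hm0 : 0 < m) (hn : s.reg 0 = n) (hm : s.reg 1 = m) :
    Runs O .findAllocation s (400 * (n + 1) ^ 2 * (m + 1) ^ 4) fun s' =>
      (∃ j < n, ∃ p ≤ m, ∃ q ≤ m, Reach (cutValue O) (cutValue O j (p : ℕ) (q : ℕ)) n m) →
        ∃ t, IsCutting (cutValue O) t n m (s'.arr 0) 0 0 := by
  set G : (ℤ → ℤ) → Prop := fun a => ∃ t, IsCutting (cutValue O) t n m a 0 0 with hG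
  set H : ℕ → ℕ → ℕ → Prop := fun j p q =>
    Reach (cutValue O) (cutValue O j (p : ℕ) (q : ℕ)) n m with hH
  set T := 300 * (n + 1) * (m + 1) ^ 2 with hT
  have hfour : ∀ (j p : ℕ) (s : RamState), s.reg 0 = n → s.reg 1 = m → s.reg 2 = j →
      s.reg 3 = p → Runs O (.forUp 4 (.reg 4) (.reg 1) .tryThreshold) s
        ((m + 1) * (7 + T) + 5) fun s' => (∀ r < 4, s'.reg r = s.reg r) ∧
          (G (s.arr 0) ∨ (∃ q < m + 1, H j p q) → G (s'.arr 0)) := by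
    intro j p s hn hm hj hp
    refine Runs.forUp_search G (H j p) (m + 1) T ?_ ?_ le_rfl
    · intro k s' hr hk
      simp only [RamExpr.eval, hk, hr 1 (by omega), hm]
      omega
    · intro k s' _ hr hk
      exact runs_tryThreshold ((hr 0 (by omega)).trans hn) ((hr 1 (by omega)).trans hm)
        ((hr 2 (by omega)).trans hj) ((hr 3 (by omega)).trans hp) hk
  have hthree : ∀ (j : ℕ) (s : RamState), s.reg 0 = n → s.reg 1 = m → s.reg 2 = j →
      Runs O (.forUp 3 (.reg 3) (.reg 1) (.forUp 4 (.reg 4) (.reg 1) .tryThreshold)) s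
        ((m + 1) * (7 + ((m + 1) * (7 + T) + 5)) + 5) fun s' => (∀ r < 3, s'.reg r = s.reg r) ∧
          (G (s.arr 0) ∨ (∃ p < m + 1, ∃ q < m + 1, H j p q) → G (s'.arr 0)) := by
    intro j s hn hm hj
    refine Runs.forUp_search G (fun p => ∃ q < m + 1, H j p q) (m + 1) _ ?_ ?_ le_rfl
    · intro k s' hr hk
      simp only [RamExpr.eval, hk, hr 1 (by omega), hm]
      omega
    · intro k s' _ hr hk
      exact hfour j k s' ((hr 0 (by omega)).trans hn) ((hr 1 (by omega)).trans hm)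
        ((hr 2 (by omega)).trans hj) hk
  have htwo : Runs O (.forUp 2 (.add (.reg 2) (.const 1)) (.reg 0)
      (.forUp 3 (.reg 3) (.reg 1) (.forUp 4 (.reg 4) (.reg 1) .tryThreshold))) s
        (n * (9 + ((m + 1) * (7 + ((m + 1) * (7 + T) + 5)) + 5)) + 7) fun s' =>
          (∀ r < 2, s'.reg r = s.reg r) ∧
          (G (s.arr 0) ∨ (∃ j < n, ∃ p < m + 1, ∃ q < m + 1, H j p q) → G (s'.arr 0)) := by
    refine Runs.forUp_search G (fun j => ∃ p < m + 1, ∃ q < m + 1, H j p q) n _ ?_ ?_ le_rfl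
    · intro k s' hr hk
      simp only [RamExpr.eval, hk, hr 0 (by omega), hn]
      omega
    · intro k s' _ hr hk
      exact hthree k s' ((hr 0 (by omega)).trans hn) ((hr 1 (by omega)).trans hm) hk
  refine (Runs.ite (fun h => ?_) fun _ => htwo).mono ?_ ?_
  · simp only [RamExpr.eval, hm] at h
    omega
  · simp only [RamExpr.cost, hT]
    have h1 : 1 ≤ m + 1 := by omega
    have h2 : (m + 1) * (7 + 300 * (n + 1) * (m + 1) ^ 2) + 5 ≤
        312 * (n + 1) * (m + 1) ^ 3 := by
      have e1 : m + 1 ≤ (n + 1) * (m + 1) ^ 3 := by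
        calc m + 1 = 1 * (m + 1) ^ 1 := by ring
          _ ≤ _ := Nat.mul_le_mul (by omega) (Nat.pow_le_pow_right h1 (by omega))
      nlinarith
    have h3 : (m + 1) * (7 + 312 * (n + 1) * (m + 1) ^ 3) + 5 ≤
        324 * (n + 1) * (m + 1) ^ 4 := by
      have e1 : m + 1 ≤ (n + 1) * (m + 1) ^ 4 := by
        calc m + 1 = 1 * (m + 1) ^ 1 := by ring
          _ ≤ _ := Nat.mul_le_mul (by omega) (Nat.pow_le_pow_right h1 (by omega))
      nlinarith
    have h4 : 1 ≤ (n + 1) * (m + 1) ^ 4 := Nat.mul_pos (by omega) (by positivity)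
    calc _ ≤ 1 + 1 + 1 + (n * (9 + 324 * (n + 1) * (m + 1) ^ 4) + 7) := by
          gcongr
          exact (by gcongr : _ ≤ _).trans h3
      _ ≤ _ := by nlinarith
  · rintro s' ⟨-, h⟩ ⟨j, hj, p, hp, q, hq, hr⟩
    exact h (Or.inr ⟨j, hj, p, by omega, q, by omega, hr⟩)

end Specifications

/-! ### From cuts to allocations -/

theorem mem_pathInterval {m : ℕ} {l r : ℤ} {x : Fin m} :
    x ∈ pathInterval m l r ↔ l ≤ (x : ℤ) + 1 ∧ (x : ℤ) + 1 ≤ r := by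
  simp [pathInterval]

theorem pathInterval_eq_empty {m : ℕ} {l r : ℤ} (h : r < l) : pathInterval m l r = ∅ := by
  ext x
  simp only [mem_pathInterval, Finset.notMem_empty, iff_false]
  omega

/-- `S'` arises from the bundle between the cuts `x` and `y` by removing at most one end item. -/
def IsTrimmed {m : ℕ} (x y : ℤ) (S' : Finset (Fin m)) : Prop :=
  S' = pathInterval m (x + 1) y ∨ S' = pathInterval m (x + 1 + 1) y ∨
    S' = pathInterval m (x + 1) (y - 1)

theorem IsTrimmed.isConnectedBundle {m : ℕ} {x y : ℤ} {S' : Finset (Fin m)}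
    (h : IsTrimmed x y S') : IsConnectedBundle S' := by
  rcases h with h | h | h <;> exact ⟨_, _, h⟩

theorem IsTrimmed.subset {m : ℕ} {x y : ℤ} {S' : Finset (Fin m)}
    (h : IsTrimmed x y S') : S' ⊆ pathInterval m (x + 1) y := by
  intro z
  rcases h with rfl | rfl | rfl <;> simp only [mem_pathInterval] <;> omega

theorem IsTrimmed.card_sdiff_le {m : ℕ} {x y : ℤ} {S' : Finset (Fin m)}
    (h : IsTrimmed x y S') : (pathInterval m (x + 1) y \ S').card ≤ 1 := by
  rw [Finset.card_le_one]
  intro a ha b hb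
  rcases h with rfl | rfl | rfl <;>
    · simp only [Finset.mem_sdiff, mem_pathInterval] at ha hb
      rw [Fin.ext_iff]
      omega

theorem Straddles.exists_isTrimmed {m : ℕ} {g : ℤ → ℤ → ℤ} {u : Finset (Fin m) → ℤ} {t x y : ℤ}
    (hg : ∀ x y, g x y = u (pathInterval m (x + 1) y)) (h : Straddles g t x y) :
    (∃ S', IsTrimmed x y S' ∧ u S' ≤ t) ∧ ∃ S', IsTrimmed x y S' ∧ t ≤ u S' := by
  unfold Straddles at h
  simp only [min_le_iff, le_max_iff, hg] at h
  obtain ⟨h1, h2⟩ := h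
  constructor
  · rcases h1 with h | h | h
    exacts [⟨_, Or.inl rfl, h⟩, ⟨_, Or.inr (Or.inl rfl), h⟩, ⟨_, Or.inr (Or.inr rfl), h⟩]
  · rcases h2 with h | h | h
    exacts [⟨_, Or.inl rfl, h⟩, ⟨_, Or.inr (Or.inl rfl), h⟩, ⟨_, Or.inr (Or.inr rfl), h⟩]

/-- If all bundles straddle a common threshold, then any two of them can be trimmed to values on the
right sides of the threshold. -/
theorem IsCutting.exists_allocation {f : ℕ → ℤ → ℤ → ℤ} {t : ℤ} {n m : ℕ}
    {v : Fin n → Finset (Fin m) → ℤ} {s : RamState}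
    (hf : ∀ (i : Fin n) (x y : ℤ), f i x y = v i (pathInterval m (x + 1) y))
    (h : IsCutting f t n m (s.arr 0) 0 0) :
    ∃ A : Fin n → Finset (Fin m), Represents s A ∧ IsEQ1P v A ∧ IsWellOrdered A := by
  obtain ⟨c, hc0, hcn, hc⟩ := h
  have hmono : ∀ i j, i ≤ j → j ≤ n → c i ≤ c j := by
    intro i j hij
    induction j, hij using Nat.le_induction with
    | base => exact fun _ => le_rfl
    | succ j _ ih => exact fun hj => (ih (by omega)).trans (hc j (Nat.zero_le _) hj).2.1
  -- Every item lies between two consecutive cuts.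
  have hcover : ∀ z : ℕ, z < m → ∃ i < n, c i ≤ z ∧ z < c (i + 1) := by
    intro z hz
    by_contra! hno
    have : ∀ i ≤ n, c i ≤ z := by
      intro i
      induction i with
      | zero => intro _; omega
      | succ i ih => intro hi; exact hno i hi (ih (by omega))
    have := this n le_rfl
    omega
  set A : Fin n → Finset (Fin m) := fun i => pathInterval m ((c i : ℤ) + 1) (c (i + 1)) with hA
  have hmem : ∀ (i : Fin n) (x : Fin m), x ∈ A i ↔ c i ≤ x ∧ (x : ℕ) < c (i + 1) := by
    intro i x
    simp only [hA, mem_pathInterval]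
    omega
  have hrep : ∀ (x : Fin m) (i : Fin n), x ∈ A i → s.arr 0 ((x : ℤ) + 1) = (i : ℤ) + 1 := by
    intro x i hx
    rw [hmem] at hx
    have := (hc i (Nat.zero_le _) i.2).2.2.2 (x + 1) (by omega) (by omega)
    exact_mod_cast this
  have hex : ∀ x : Fin m, ∃ i, x ∈ A i := by
    intro x
    obtain ⟨i, hi, hx⟩ := hcover x x.2
    exact ⟨⟨i, hi⟩, (hmem _ _).2 hx⟩
  have huniq : ∀ (x : Fin m) (i j : Fin n), x ∈ A i → x ∈ A j → i = j := by
    intro x i j hi hj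
    have := (hrep x i hi).symm.trans (hrep x j hj)
    exact Fin.ext (by omega)
  refine ⟨A, ?_, ⟨?_, ?_, ?_⟩, ?_⟩
  · refine fun x i => ⟨hrep x i, fun h => ?_⟩
    obtain ⟨j, hj⟩ := hex x
    have hij := (hrep x j hj).symm.trans h
    obtain rfl : j = i := Fin.ext (by omega)
    exact hj
  · intro x
    obtain ⟨i, hi⟩ := hex x
    exact ⟨i, hi, fun j hj => huniq x j i hj hi⟩
  · exact fun i => ⟨_, _, rfl⟩
  · intro i j hlt
    have hij : i ≠ j := by rintro rfl; exact lt_irrefl _ hlt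
    have hdisj : Disjoint (A i) (A j) :=
      Finset.disjoint_left.2 fun x hi hj => hij (huniq x i j hi hj)
    obtain ⟨Si, hSi, hvi⟩ :=
      ((hc i (Nat.zero_le _) i.2).2.2.1.exists_isTrimmed (u := v i) (hf i)).2
    obtain ⟨Sj, hSj, hvj⟩ :=
      ((hc j (Nat.zero_le _) j.2).2.2.1.exists_isTrimmed (u := v j) (hf j)).1
    have hi1 : A i ∩ (A i \ Si ∪ A j \ Sj) = A i \ Si := by
      ext x
      have : x ∈ A i → x ∉ A j := fun h => Finset.disjoint_left.1 hdisj h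
      simp only [Finset.mem_inter, Finset.mem_union, Finset.mem_sdiff]
      tauto
    have hj1 : A j ∩ (A i \ Si ∪ A j \ Sj) = A j \ Sj := by
      ext x
      have : x ∈ A i → x ∉ A j := fun h => Finset.disjoint_left.1 hdisj h
      simp only [Finset.mem_inter, Finset.mem_union, Finset.mem_sdiff]
      tauto
    have hi2 : A i \ (A i \ Si ∪ A j \ Sj) = Si := by
      rw [← Finset.sdiff_inter_self_left, hi1, Finset.sdiff_sdiff_eq_self hSi.subset]
    have hj2 : A j \ (A i \ Si ∪ A j \ Sj) = Sj := by
      rw [← Finset.sdiff_inter_self_left, hj1, Finset.sdiff_sdiff_eq_self hSj.subset]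
    refine ⟨A i \ Si ∪ A j \ Sj, ?_, ?_, ?_, ?_, ?_⟩
    · rw [hi1]; exact hSi.card_sdiff_le
    · rw [hj1]; exact hSj.card_sdiff_le
    · rw [hi2]; exact hSi.isConnectedBundle
    · rw [hj2]; exact hSj.isConnectedBundle
    · rw [hi2, hj2]; exact hvj.trans hvi
  · intro i j hij x hx y hy
    rw [hmem] at hx hy
    have := hmono (i + 1) j hij (by omega)
    rw [Fin.lt_def]
    omega

theorem cutValue_valuationOracle {n m : ℕ} (v : Fin n → Finset (Fin m) → ℤ) (i : Fin n) (x y : ℤ) :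
    cutValue (valuationOracle v) i x y = v i (pathInterval m (x + 1) y) := by
  have h : (1 : ℤ) ≤ (i : ℤ) + 1 ∧ (i : ℤ) + 1 ≤ n := by omega
  simp [cutValue, valuationOracle, h]

theorem mainTheorem6 :
    ∃ (p : RamProg) (C : ℕ),
      ∀ (n m : ℕ), 0 < n →
      ∀ v : Fin n → Finset (Fin m) → ℤ,
        (∀ i, v i ∅ = 0) →
        (∀ i S, 0 ≤ v i S) →
        ∃ (t : ℕ) (s : RamState) (A : Fin n → Finset (Fin m)),
          RamExec (valuationOracle v) p (initialState n m) t s ∧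
          t ≤ C * max 1 (n ^ 2 * m ^ 4) ∧
          Represents s A ∧
          IsEQ1P v A ∧
          IsWellOrdered A := by
  -- `64 = 2 ^ 2 * 2 ^ 4` comes from `n + 1 ≤ 2 * n` and `m + 1 ≤ 2 * m`.
  refine ⟨.findAllocation, 400 * 64, fun n m hn v hv0 hvnn => ?_⟩
  rcases Nat.eq_zero_or_pos m with rfl | hm
  · -- Without items the program stops at once.
    have hempty : Runs (valuationOracle v) .findAllocation (initialState n 0) 4 fun _ => True := by
      refine (Runs.ite (T := 1) (fun _ => .of_loopFree rfl le_rfl trivial) fun h => ?_).mono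
        le_rfl fun _ h => h
      simp [RamExpr.eval, initialState] at h
    obtain ⟨t, s, he, ht, -⟩ := hempty
    refine ⟨t, s, fun _ => ∅, he, by simp; omega, fun x => x.elim0, ⟨fun x => x.elim0,
      fun _ => ⟨1, 0, (pathInterval_eq_empty (by omega)).symm⟩, fun i j h => ?_⟩,
      fun _ _ _ x => x.elim0⟩
    simp [hv0] at h
  · have h0 : ∀ i x y, y ≤ x → cutValue (valuationOracle v) i x y = 0 := by
      intro i x y hxy
      unfold cutValue valuationOracle
      split_ifs
      · rw [pathInterval_eq_empty (by omega), hv0]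
      · rfl
    have hnn : ∀ i x y, 0 ≤ cutValue (valuationOracle v) i x y := by
      intro i x y
      unfold cutValue valuationOracle
      split_ifs
      · exact hvnn _ _
      · exact le_rfl
    obtain ⟨t, s, he, ht, hs⟩ := runs_findAllocation (O := valuationOracle v)
      (s := initialState n m) (n := n) hm (by simp [initialState]) (by simp [initialState])
    obtain ⟨τ, hτ⟩ := hs (exists_reach_value hn hm h0 hnn)
    obtain ⟨A, hA⟩ := hτ.exists_allocation (cutValue_valuationOracle v)
    refine ⟨t, s, A, he, ht.trans ?_, hA⟩
    calc 400 * (n + 1) ^ 2 * (m + 1) ^ 4 ≤ 400 * (2 * n) ^ 2 * (2 * m) ^ 4 := by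
          gcongr <;> omega
      _ = 400 * 64 * (n ^ 2 * m ^ 4) := by ring
      _ ≤ _ := Nat.mul_le_mul_left _ (le_max_right _ _)
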